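/- Let $X$ be a real Banach space. For a Lipschitz function $h$ on a set $A\subset X$, let $\operatorname{Lip}(h)$ denote its (least) Lipschitz constant. Assume that $X$ has property $(*)$: there is a constant $C_0\ge 0$, depending only on $X$, such that for every Lipschitz function $g:X\to\mathbb{R}$ and every $\varepsilon>0$ there is a $\mathcal{C}^1$-smooth Lipschitz function $K:X\to\mathbb{R}$ with $|g(x)-K(x)|<\varepsilon$ for all $x\in X$ and $\operatorname{Lip}(K)\le C_0\operatorname{Lip}(g)$. Then there is a constant $C\ge 0$, depending only on $X$, such that the following holds. Let $Y\subset X$ be closed and convex, let $U\subset X$ be an open set containing $Y$, and let $f:U\to\mathbb{R}$ be differentiable at every point of $Y$, with $y\mapsto f'(y)$ continuous from $Y$ to $X^*$ (with the norm topology). Then: 1. there is a $\mathcal{C}^1$-smooth function $H:X\to\mathbb{R}$ with $H|_Y=f|_Y$; 2. if moreover $f|_Y$ is Lipschitz, then there is a $\mathcal{C}^1$-smooth Lipschitz function $H:X\to\mathbb{R}$ with $H|_Y=f|_Y$ and $\operatorname{Lip}(H)\le C\operatorname{Lip}(f|_Y)$. -/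

import Mathlib

open scoped NNReal

/-- The Lipschitz constant `Lip(f|_Y)`: the least `K ≥ 0` such that
`|f x - f y| ≤ K * ‖x - y‖` for all `x, y ∈ Y`. It is meaningful when `f` is Lipschitz on `Y`
(otherwise the infimum is over the empty set and equals `0`). -/
noncomputable def lipConst {X : Type*} [NormedAddCommGroup X] (f : X → ℝ) (Y : Set X) : ℝ≥0 :=
  sInf {K : ℝ≥0 | LipschitzOnWith K f Y}

/-- If `f` is Lipschitz on `Y`, then the infimum is attained. -/
theorem lipschitzOnWith_lipConst {X : Type*} [NormedAddCommGroup X] {f : X → ℝ} {Y : Set X}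
    (h : ∃ K : ℝ≥0, LipschitzOnWith K f Y) : LipschitzOnWith (lipConst f Y) f Y := by
  have hcl : IsClosed {K : ℝ≥0 | LipschitzOnWith K f Y} := by
    have : {K : ℝ≥0 | LipschitzOnWith K f Y} =
        ⋂ x ∈ Y, ⋂ y ∈ Y, {K : ℝ≥0 | dist (f x) (f y) ≤ K * dist x y} := by
      ext K
      simp [lipschitzOnWith_iff_dist_le_mul]
    rw [this]
    refine isClosed_biInter fun x _ => isClosed_biInter fun y _ => ?_
    exact isClosed_le continuous_const (NNReal.continuous_coe.mul continuous_const)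
  exact hcl.csInf_mem h (OrderBot.bddBelow _)

/-- `lipConst f Y` is at most every Lipschitz constant of `f` on `Y`. -/
theorem lipConst_le {X : Type*} [NormedAddCommGroup X] {f : X → ℝ} {Y : Set X} {K : ℝ≥0}
    (h : LipschitzOnWith K f Y) : lipConst f Y ≤ K :=
  csInf_le (OrderBot.bddBelow _) h

/-- Property `(*)`: there is a constant `C₀`, depending only on `X`, such that every Lipschitz
`f : X → ℝ` is, for every `ε > 0`, uniformly `ε`-close to a `C¹`-smooth Lipschitz function `K`
with `Lip(K) ≤ C₀ * Lip(f)`. -/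
def PropertyStar (X : Type*) [NormedAddCommGroup X] [NormedSpace ℝ X] : Prop :=
  ∃ C₀ : ℝ≥0, ∀ f : X → ℝ, (∃ L : ℝ≥0, LipschitzWith L f) → ∀ ε : ℝ, 0 < ε →
    ∃ K : X → ℝ, ContDiff ℝ 1 K ∧ (∀ x, |f x - K x| < ε) ∧
      LipschitzWith (C₀ * lipConst f Set.univ) K

/-- `f : U → ℝ` is `C¹`-smooth on `Y` as a function on the open set `U ⊇ Y`: it is differentiable
at every point of `Y`, and `y ↦ f'(y)` is continuous from `Y` to the dual `X^*` with its norm.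
The function is represented by a total function whose values outside `U` play no role. -/
def IsC1OnAsFunctionOn {X : Type*} [NormedAddCommGroup X] [NormedSpace ℝ X]
    (f : X → ℝ) (U Y : Set X) : Prop :=
  (∀ y ∈ Y, DifferentiableWithinAt ℝ f U y) ∧ ContinuousOn (fderivWithin ℝ f U) Y

/-! If `f` is `L`-Lipschitz on the convex set `Y`, then `f'(y)` is bounded by `L` only on
differences of points of `Y`; transversally it may be huge. Hahn–Banach gives a functional `T` of
norm at most `L` with the same values on these differences. Continuity of `f'` and convexity make `f
- T` Lipschitz with small constant on `Y` near `y`, so it can be extended to `X` and smoothed by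
property (*). Gluing the resulting local models (`exists_glue`) gives a `C¹` function `g` with `f -
g` bounded by `L/2` and `L/2`-Lipschitz on `Y` (`exists_contDiff_approx_on_convex`).

Since `g` has small derivative on `Y`, it is Lipschitz near `Y`, and it can be changed off `Y` into
a globally Lipschitz `C¹` function `H` (`exists_lipschitz_contDiff_eqOn`). The remainder `f - H`
satisfies the same hypotheses with `L/2`. Iterating gives a series of functions `H` whose
derivatives decay geometrically; its sum is the extension.

Without the Lipschitz hypothesis, `T = f'(y)` serves: some `C¹` function `g` makes `f - g`
1-Lipschitz on `Y`, and the Lipschitz case applies to `f - g`. -/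

/-- Every `L`-Lipschitz function on `X` is uniformly approximable by `C¹` functions that are
`C₀ * L`-Lipschitz. -/
def LipschitzSmoothApprox (X : Type*) [NormedAddCommGroup X] [NormedSpace ℝ X] (C₀ : ℝ≥0) : Prop :=
  ∀ (f : X → ℝ) (L : ℝ≥0), LipschitzWith L f → ∀ ε : ℝ, 0 < ε →
    ∃ k : X → ℝ, ContDiff ℝ 1 k ∧ (∀ x, |f x - k x| < ε) ∧ LipschitzWith (C₀ * L) k

theorem PropertyStar.exists_lipschitzSmoothApprox {X : Type*} [NormedAddCommGroup X]
    [NormedSpace ℝ X] (hX : PropertyStar X) : ∃ C₀, LipschitzSmoothApprox X C₀ := by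
  obtain ⟨C₀, h⟩ := hX
  refine ⟨C₀, fun f L hf ε hε => ?_⟩
  obtain ⟨k, hk, hfk, hL⟩ := h f ⟨L, hf⟩ ε hε
  refine ⟨k, hk, hfk, hL.weaken ?_⟩
  gcongr
  exact lipConst_le hf.lipschitzOnWith

/-! ### Smooth cutoffs -/

/-- A `C¹` function with values in `[0, 1]` and bounded derivative. -/
structure IsCutoff {X : Type*} [NormedAddCommGroup X] [NormedSpace ℝ X] (φ : X → ℝ) : Prop where
  contDiff : ContDiff ℝ 1 φ
  nonneg : ∀ x, 0 ≤ φ x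
  le_one : ∀ x, φ x ≤ 1
  bounded_fderiv : ∃ M : ℝ, ∀ x, ‖fderiv ℝ φ x‖ ≤ M

namespace IsCutoff

variable {X : Type*} [NormedAddCommGroup X] [NormedSpace ℝ X] {φ ψ : X → ℝ}

theorem const {c : ℝ} (h0 : 0 ≤ c) (h1 : c ≤ 1) : IsCutoff (fun _ : X => c) :=
  ⟨contDiff_const, fun _ => h0, fun _ => h1, 0, fun x => by simp⟩

theorem one_sub (h : IsCutoff φ) : IsCutoff (fun x => 1 - φ x) := by
  obtain ⟨M, hM⟩ := h.bounded_fderiv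
  refine ⟨contDiff_const.sub h.contDiff, fun x => by linarith [h.le_one x],
    fun x => by linarith [h.nonneg x], M, fun x => ?_⟩
  rw [fderiv_const_sub, norm_neg]
  exact hM x

theorem mul (hφ : IsCutoff φ) (hψ : IsCutoff ψ) : IsCutoff (fun x => φ x * ψ x) := by
  obtain ⟨M, hM⟩ := hφ.bounded_fderiv
  obtain ⟨N, hN⟩ := hψ.bounded_fderiv
  refine ⟨hφ.contDiff.mul hψ.contDiff, fun x => mul_nonneg (hφ.nonneg x) (hψ.nonneg x),
    fun x => mul_le_one₀ (hφ.le_one x) (hψ.nonneg x) (hψ.le_one x), N + M, fun x => ?_⟩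
  rw [fderiv_fun_mul (hφ.contDiff.differentiable one_ne_zero x)
    (hψ.contDiff.differentiable one_ne_zero x)]
  refine (norm_add_le _ _).trans (add_le_add ?_ ?_)
  · rw [norm_smul, Real.norm_of_nonneg (hφ.nonneg x)]
    exact (mul_le_of_le_one_left (norm_nonneg _) (hφ.le_one x)).trans (hN x)
  · rw [norm_smul, Real.norm_of_nonneg (hψ.nonneg x)]
    exact (mul_le_of_le_one_left (norm_nonneg _) (hψ.le_one x)).trans (hM x)

theorem prod_range {φ : ℕ → X → ℝ} (h : ∀ n, IsCutoff (φ n)) (n : ℕ) :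
    IsCutoff (fun x => ∏ k ∈ Finset.range n, φ k x) := by
  induction n with
  | zero => simpa using const zero_le_one le_rfl
  | succ n ih =>
    simp only [Finset.prod_range_succ]
    exact ih.mul (h n)

end IsCutoff

theorem Real.exists_lipschitzWith_smoothTransition :
    ∃ M : ℝ≥0, LipschitzWith M Real.smoothTransition := by
  have hc : ContDiff ℝ 1 Real.smoothTransition := Real.smoothTransition.contDiff
  obtain ⟨M, hM⟩ := (isCompact_Icc (a := (0 : ℝ)) (b := 1)).exists_bound_of_continuousOn
    (hc.continuous_deriv le_rfl).continuousOn
  refine ⟨M.toNNReal, lipschitzWith_of_nnnorm_deriv_le (hc.differentiable one_ne_zero) fun x => ?_⟩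
  rw [← NNReal.coe_le_coe, coe_nnnorm]
  rcases lt_or_ge x 0 with hx | hx
  · have : Real.smoothTransition =ᶠ[nhds x] fun _ => 0 := by
      filter_upwards [Iio_mem_nhds hx] with y hy
      exact Real.smoothTransition.zero_of_nonpos (le_of_lt hy)
    rw [this.deriv_eq]; simp
  rcases lt_or_ge 1 x with hx' | hx'
  · have : Real.smoothTransition =ᶠ[nhds x] fun _ => 1 := by
      filter_upwards [Ioi_mem_nhds hx'] with y hy
      exact Real.smoothTransition.one_of_one_le (le_of_lt hy)
    rw [this.deriv_eq]; simp
  exact (hM x ⟨hx, hx'⟩).trans (Real.le_coe_toNNReal M)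

section

variable {X : Type*} [NormedAddCommGroup X] [NormedSpace ℝ X] {C₀ : ℝ≥0}

/-- Smooth the distance to `S` and compose with a one-dimensional transition. -/
theorem LipschitzSmoothApprox.exists_isCutoff (hX : LipschitzSmoothApprox X C₀) (S : Set X) {r : ℝ}
    (hr : 0 < r) : ∃ φ : X → ℝ, IsCutoff φ ∧ (∀ x ∈ S, ∀ᶠ z in nhds x, φ z = 1) ∧
      ∀ x ∉ Metric.thickening r S, ∀ᶠ z in nhds x, φ z = 0 := by
  rcases S.eq_empty_or_nonempty with rfl | hS
  · exact ⟨fun _ => 0, .const le_rfl zero_le_one, by simp, by simp⟩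
  obtain ⟨k, hk, hdk, hkL⟩ := hX (fun x => Metric.infDist x S) 1 (Metric.lipschitz_infDist_pt S)
    (r / 8) (by linarith)
  obtain ⟨M, hM⟩ := Real.exists_lipschitzWith_smoothTransition
  have hcont : Continuous fun x => Metric.infDist x S := Metric.continuous_infDist_pt S
  -- `a ≥ 1` up to `r / 4` and `a ≤ 0` from `r / 2` on; the error `r / 8` of `k` leaves room for
  -- neighbourhoods on both sides.
  let a : ℝ → ℝ := fun t => (4 / r) * (r / 2 - t)
  have ha : LipschitzWith (Real.toNNReal (4 / r)) a := by
    refine LipschitzWith.of_dist_le_mul fun s t => ?_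
    rw [Real.coe_toNNReal _ (by positivity), Real.dist_eq, Real.dist_eq, ← abs_neg (s - t)]
    conv_rhs => rw [← abs_of_pos (show 0 < 4 / r by positivity), ← abs_mul]
    simp only [a]
    apply le_of_eq; congr 1; ring
  refine ⟨fun x => Real.smoothTransition (a (k x)), ⟨?_, fun x => Real.smoothTransition.nonneg _,
    fun x => Real.smoothTransition.le_one _, _,
    fun x => norm_fderiv_le_of_lipschitz ℝ (hM.comp (ha.comp hkL))⟩, fun x hx => ?_, fun x hx => ?_⟩
  · exact (Real.smoothTransition.contDiff (n := 1)).comp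
      (contDiff_const.mul (contDiff_const.sub hk))
  · have h0 : Metric.infDist x S < r / 8 := by
      rw [Metric.infDist_zero_of_mem hx]; linarith
    filter_upwards [hcont.continuousAt.eventually_lt_const h0] with z hz
    apply Real.smoothTransition.one_of_one_le
    have := abs_lt.1 (hdk z)
    calc (1 : ℝ) = 4 / r * (r / 4) := by field_simp
      _ ≤ 4 / r * (r / 2 - k z) := by gcongr; linarith
  · rw [Metric.mem_thickening_iff_infDist_lt hS, not_lt] at hx
    have h0 : 3 * r / 4 < Metric.infDist x S := by linarith
    filter_upwards [hcont.continuousAt.eventually_const_lt h0] with z hz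
    apply Real.smoothTransition.zero_of_nonpos
    have := abs_lt.1 (hdk z)
    exact mul_nonpos_of_nonneg_of_nonpos (by positivity) (by linarith)

/-! ### Partitions of unity and gluing -/

/-- A sequence of cutoffs subordinate to the disjoint unions of small subsets of a given open
cover, locally finite and with sum one. -/
theorem LipschitzSmoothApprox.exists_partition (hX : LipschitzSmoothApprox X C₀) {U : X → Set X}
    (hU : ∀ x, IsOpen (U x)) (hxU : ∀ x, x ∈ U x) :
    ∃ (W : ℕ → Set X) (i : ℕ → X → X) (ψ : ℕ → X → ℝ), (∀ n, IsOpen (W n)) ∧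
      (∀ n, ∀ x ∈ W n, x ∈ U (i n x) ∧ ∀ᶠ z in nhds x, i n z = i n x) ∧
      (∀ n, IsCutoff (ψ n)) ∧ (∀ n, ∀ x ∉ W n, ∀ᶠ z in nhds x, ψ n z = 0) ∧
      ∀ x, ∃ N, ∀ᶠ z in nhds x, (∀ n, N ≤ n → ψ n z = 0) ∧ ∑ n ∈ Finset.range N, ψ n z = 1 := by
  classical
  have hwf : WellFounded (WellOrderingRel : X → X → Prop) := IsWellFounded.wf
  let ind : X → X := fun x => hwf.min {c | x ∈ U c} ⟨x, hxU x⟩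
  have hind : ∀ x, x ∈ U (ind x) := fun x => hwf.min_mem {c | x ∈ U c} ⟨x, hxU x⟩
  have hmin : ∀ x j, WellOrderingRel j (ind x) → x ∉ U j := fun x j hj hx =>
    hwf.not_lt_min {c | x ∈ U c} hx hj
  let r : ℕ → ℝ := fun n => (1 / 2) ^ n
  have hr : ∀ n, 0 < r n := fun n => by positivity
  -- As in M. E. Rudin's proof of paracompactness: `ind` is the least index, so points of `S n`
  -- closer than `3 * r n` share it. Thickening by half of this makes the index well defined and
  -- locally constant on `W n`.
  let S : ℕ → Set X := fun n => {c | Metric.ball c (3 * r n) ⊆ U (ind c)}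
  let W : ℕ → Set X := fun n => Metric.thickening (3 / 2 * r n) (S n)
  have hsep : ∀ n, ∀ c ∈ S n, ∀ d ∈ S n, dist c d < 3 * r n → ind c = ind d := by
    have key : ∀ n, ∀ c ∈ S n, ∀ d, dist c d < 3 * r n → ¬ WellOrderingRel (ind c) (ind d) :=
      fun n c hc d hcd hlt => hmin d _ hlt (hc (by rwa [Metric.mem_ball, dist_comm]))
    intro n c hc d hd hcd
    rcases trichotomous_of WellOrderingRel (ind c) (ind d) with h | h | h
    · exact absurd h (key n c hc d hcd)
    · exact h
    · exact absurd h (key n d hd c (by rwa [dist_comm]))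
  let i : ℕ → X → X := fun n x =>
    if h : ∃ c ∈ S n, dist x c < 3 / 2 * r n then ind h.choose else x
  have hi : ∀ n, ∀ c ∈ S n, ∀ x, dist x c < 3 / 2 * r n → i n x = ind c := by
    intro n c hc x hx
    have h : ∃ c ∈ S n, dist x c < 3 / 2 * r n := ⟨c, hc, hx⟩
    simp only [i, dif_pos h]
    refine hsep n _ h.choose_spec.1 _ hc ?_
    have := dist_triangle_left h.choose c x
    linarith [h.choose_spec.2]
  choose φ hφ hφ1 hφ0 using fun n => hX.exists_isCutoff (S n) (show 0 < 3 / 2 * r n by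
    linarith [hr n])
  -- Partial sums telescope to `1 - ∏ (1 - φ k)`; once some `φ N = 1`, all later terms vanish.
  let ψ : ℕ → X → ℝ := fun n x => φ n x * ∏ k ∈ Finset.range n, (1 - φ k x)
  have hsum : ∀ N x, ∑ n ∈ Finset.range N, ψ n x = 1 - ∏ k ∈ Finset.range N, (1 - φ k x) := by
    intro N x
    induction N with
    | zero => simp
    | succ N ih => rw [Finset.sum_range_succ, ih, Finset.prod_range_succ]; ring
  have hzero : ∀ N x, φ N x = 1 → ∀ n, N < n → ∏ k ∈ Finset.range n, (1 - φ k x) = 0 :=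
    fun N x h n hn => Finset.prod_eq_zero (Finset.mem_range.2 hn) (by simp [h])
  refine ⟨W, i, ψ, fun n => Metric.isOpen_thickening, fun n x hx => ?_, fun n =>
    (hφ n).mul (.prod_range (fun k => (hφ k).one_sub) n), fun n x hx => ?_, fun x => ?_⟩
  · obtain ⟨c, hc, hxc⟩ := Metric.mem_thickening_iff.1 hx
    rw [hi n c hc x hxc]
    refine ⟨hc (Metric.mem_ball.2 (by linarith [hr n])), ?_⟩
    filter_upwards [Metric.isOpen_ball.mem_nhds (Metric.mem_ball.2 hxc)] with z hz
    exact hi n c hc z hz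
  · filter_upwards [hφ0 n x hx] with z hz
    simp [ψ, hz]
  · obtain ⟨N, hN⟩ : ∃ N, x ∈ S N := by
      obtain ⟨ε, hε, hball⟩ := Metric.isOpen_iff.1 (hU (ind x)) x (hind x)
      obtain ⟨N, hN⟩ := exists_pow_lt_of_lt_one (show 0 < ε / 3 by linarith)
        (show (1 / 2 : ℝ) < 1 by norm_num)
      exact ⟨N, (Metric.ball_subset_ball (by simp only [r]; linarith)).trans hball⟩
    refine ⟨N + 1, ?_⟩
    filter_upwards [hφ1 N x hN] with z hz
    refine ⟨fun n hn => ?_, ?_⟩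
    · simp only [ψ, hzero N z hz n hn, mul_zero]
    · rw [hsum, hzero N z hz _ (Nat.lt_succ_self N), sub_zero]

/-- Gluing local `C¹` approximations of a function `F` on `A` whose derivatives satisfy pointwise
convex constraints `K`. -/
theorem LipschitzSmoothApprox.exists_glue (hX : LipschitzSmoothApprox X C₀) (A : Set X) (F : X → ℝ)
    (K : X → Set (X →L[ℝ] ℝ)) (hK : ∀ x, Convex ℝ (K x)) (ε : X → ℝ) (hε : ∀ x, 0 ≤ ε x)
    (hloc : ∀ x, ∃ U : Set X, IsOpen U ∧ x ∈ U ∧ ∀ η : ℝ, 0 < η → ∃ h : X → ℝ,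
      ContDiffOn ℝ 1 h U ∧ ∀ z ∈ U, z ∈ A → |h z - F z| ≤ η * ε z ∧ fderiv ℝ h z ∈ K z) :
    ∃ g : X → ℝ, ContDiff ℝ 1 g ∧
      ∀ z ∈ A, |g z - F z| ≤ ε z ∧ ∃ k ∈ K z, ‖fderiv ℝ g z - k‖ ≤ ε z := by
  classical
  choose U hU hxU happ using hloc
  obtain ⟨W, i, ψ, hW, hi, hψ, hψ0, hfin⟩ := hX.exists_partition hU hxU
  choose M hM using fun n => (hψ n).bounded_fderiv
  have hM0 : ∀ n, 0 ≤ M n := fun n => (norm_nonneg _).trans (hM n 0)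
  -- The errors are scaled so that the sum of `η n * M n` is at most 1.
  let η : ℕ → ℝ := fun n => (1 / 2) ^ n / 2 / (M n + 1)
  have hη : ∀ n, 0 < η n := fun n => div_pos (by positivity) (by linarith [hM0 n])
  have hη1 : ∀ n, η n ≤ 1 := fun n => by
    refine div_le_one_of_le₀ ?_ (by linarith [hM0 n])
    have : ((1 : ℝ) / 2) ^ n ≤ 1 := pow_le_one₀ (by norm_num) (by norm_num)
    linarith [hM0 n]
  have hηM : ∀ n, η n * M n ≤ 1 / 2 / 2 ^ n := fun n => by
    rw [div_mul_eq_mul_div, div_le_iff₀ (by linarith [hM0 n])]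
    have : (0 : ℝ) ≤ 1 / 2 / 2 ^ n := by positivity
    have h2 : ((1 : ℝ) / 2) ^ n / 2 = 1 / 2 / 2 ^ n := by rw [one_div_pow]; ring
    rw [h2]
    nlinarith [hM0 n]
  choose h hh hhA using fun (n : ℕ) (c : X) => happ c (η n) (hη n)
  let w : ℕ → X → ℝ := fun n x => h n (i n x) x
  have hw : ∀ n, ∀ x ∈ W n, w n =ᶠ[nhds x] h n (i n x) := fun n x hx => by
    filter_upwards [(hi n x hx).2] with z hz
    simp only [w, hz]
  have hwc : ∀ n, ∀ x ∈ W n, ContDiffAt ℝ 1 (w n) x := fun n x hx =>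
    ((hh n _).contDiffAt ((hU _).mem_nhds (hi n x hx).1)).congr_of_eventuallyEq (hw n x hx)
  have hwA : ∀ n, ∀ x ∈ W n, x ∈ A → |w n x - F x| ≤ η n * ε x ∧ fderiv ℝ (w n) x ∈ K x :=
    fun n x hx hxA => by
      rw [(hw n x hx).fderiv_eq]
      exact hhA n _ x (hi n x hx).1 hxA
  have hz : ∀ n, ∀ x ∉ W n, ψ n x = 0 ∧ fderiv ℝ (ψ n) x = 0 := fun n x hx => by
    refine ⟨(hψ0 n x hx).self_of_nhds, ?_⟩
    have : ψ n =ᶠ[nhds x] fun _ => 0 := hψ0 n x hx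
    rw [this.fderiv_eq]; simp
  have htc : ∀ n x, ContDiffAt ℝ 1 (fun z => ψ n z * w n z) x := fun n x => by
    by_cases hx : x ∈ W n
    · exact (hψ n).contDiff.contDiffAt.mul (hwc n x hx)
    · refine (contDiffAt_const (c := (0 : ℝ))).congr_of_eventuallyEq ?_
      filter_upwards [hψ0 n x hx] with z hz
      simp [hz]
  have htd : ∀ n x, HasFDerivAt (fun z => ψ n z * w n z)
      (ψ n x • fderiv ℝ (w n) x + w n x • fderiv ℝ (ψ n) x) x := fun n x => by
    by_cases hx : x ∈ W n
    · exact ((hψ n).contDiff.differentiable one_ne_zero x).hasFDerivAt.mul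
        ((hwc n x hx).differentiableAt one_ne_zero).hasFDerivAt
    · rw [(hz n x hx).1, (hz n x hx).2, zero_smul, smul_zero, add_zero]
      refine (hasFDerivAt_const (0 : ℝ) x).congr_of_eventuallyEq ?_
      filter_upwards [hψ0 n x hx] with z hz
      simp [hz]
  choose N hN using hfin
  have hg : ∀ x, (fun z => ∑' n, ψ n z * w n z) =ᶠ[nhds x]
      fun z => ∑ n ∈ Finset.range (N x), ψ n z * w n z := fun x => by
    filter_upwards [hN x] with z hz
    refine tsum_eq_sum fun n hn => ?_
    rw [hz.1 n (by simpa using hn), zero_mul]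
  refine ⟨fun z => ∑' n, ψ n z * w n z, contDiff_iff_contDiffAt.2 fun x =>
    (ContDiffAt.sum fun n _ => htc n x).congr_of_eventuallyEq (hg x), fun x hxA => ?_⟩
  have hsum1 : ∑ n ∈ Finset.range (N x), ψ n x = 1 := (hN x).self_of_nhds.2
  have hbound : ∀ n, ψ n x ≠ 0 → x ∈ W n := fun n hn => by
    by_contra hx
    exact hn (hz n x hx).1
  constructor
  · rw [show (fun z => ∑' n, ψ n z * w n z) x = _ from (hg x).eq_of_nhds]
    have : ∑ n ∈ Finset.range (N x), ψ n x * w n x - F x =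
        ∑ n ∈ Finset.range (N x), ψ n x * (w n x - F x) := by
      simp only [mul_sub, Finset.sum_sub_distrib, ← Finset.sum_mul, hsum1, one_mul]
    rw [this]
    calc |∑ n ∈ Finset.range (N x), ψ n x * (w n x - F x)|
        ≤ ∑ n ∈ Finset.range (N x), |ψ n x * (w n x - F x)| := Finset.abs_sum_le_sum_abs _ _
      _ ≤ ∑ n ∈ Finset.range (N x), ψ n x * ε x := by
          refine Finset.sum_le_sum fun n _ => ?_
          rw [abs_mul, abs_of_nonneg ((hψ n).nonneg x)]
          by_cases hx : x ∈ W n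
          · refine mul_le_mul_of_nonneg_left ?_ ((hψ n).nonneg x)
            exact (hwA n x hx hxA).1.trans (mul_le_of_le_one_left (hε x) (hη1 n))
          · rw [(hz n x hx).1, zero_mul, zero_mul]
      _ = ε x := by rw [← Finset.sum_mul, hsum1, one_mul]
  -- Since the `ψ n` locally sum to 1, their derivatives sum to 0, so `w n x` may be replaced by the
  -- small `w n x - F x` in the product rule.
  · have hd0 : ∑ n ∈ Finset.range (N x), fderiv ℝ (ψ n) x = 0 := by
      have h1 : HasFDerivAt (fun z => ∑ n ∈ Finset.range (N x), ψ n z)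
          (∑ n ∈ Finset.range (N x), fderiv ℝ (ψ n) x) x := HasFDerivAt.fun_sum fun n _ =>
        ((hψ n).contDiff.differentiable one_ne_zero x).hasFDerivAt
      have h2 : (fun z => ∑ n ∈ Finset.range (N x), ψ n z) =ᶠ[nhds x] fun _ => (1 : ℝ) :=
        (hN x).mono fun z hz => hz.2
      exact h1.unique ((hasFDerivAt_const (1 : ℝ) x).congr_of_eventuallyEq h2)
    have hgd : fderiv ℝ (fun z => ∑' n, ψ n z * w n z) x =
        ∑ n ∈ Finset.range (N x), (ψ n x • fderiv ℝ (w n) x + w n x • fderiv ℝ (ψ n) x) := by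
      rw [(hg x).fderiv_eq]
      exact (HasFDerivAt.fun_sum fun n _ => htd n x).fderiv
    refine ⟨∑ n ∈ Finset.range (N x), ψ n x • fderiv ℝ (w n) x, ?_, ?_⟩
    · rw [← Finset.sum_filter_of_ne (p := fun n => ψ n x ≠ 0)
        fun n _ hn h0 => hn (by rw [h0, zero_smul])]
      refine (hK x).sum_mem (fun n _ => (hψ n).nonneg x) ?_ fun n hn => ?_
      · rw [Finset.sum_filter_of_ne (p := fun n => ψ n x ≠ 0) fun n _ hn => hn, hsum1]
      · exact (hwA n x (hbound n (Finset.mem_filter.1 hn).2) hxA).2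
    · have : fderiv ℝ (fun z => ∑' n, ψ n z * w n z) x -
          ∑ n ∈ Finset.range (N x), ψ n x • fderiv ℝ (w n) x =
          ∑ n ∈ Finset.range (N x), (w n x - F x) • fderiv ℝ (ψ n) x := by
        rw [hgd, Finset.sum_add_distrib, add_sub_cancel_left]
        simp only [sub_smul, Finset.sum_sub_distrib, ← Finset.smul_sum, hd0, smul_zero, sub_zero]
      rw [this]
      calc ‖∑ n ∈ Finset.range (N x), (w n x - F x) • fderiv ℝ (ψ n) x‖
          ≤ ∑ n ∈ Finset.range (N x), ‖(w n x - F x) • fderiv ℝ (ψ n) x‖ := norm_sum_le _ _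
        _ ≤ ∑ n ∈ Finset.range (N x), 1 / 2 / 2 ^ n * ε x := by
            refine Finset.sum_le_sum fun n _ => ?_
            have hε' := hε x
            by_cases hx : x ∈ W n
            · rw [norm_smul, Real.norm_eq_abs]
              calc |w n x - F x| * ‖fderiv ℝ (ψ n) x‖ ≤ (η n * ε x) * M n :=
                    mul_le_mul (hwA n x hx hxA).1 (hM n x) (norm_nonneg _)
                      (mul_nonneg (hη n).le hε')
                _ = (η n * M n) * ε x := by ring
                _ ≤ _ := mul_le_mul_of_nonneg_right (hηM n) hε'
            · rw [(hz n x hx).2, smul_zero, norm_zero]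
              positivity
        _ = (∑ n ∈ Finset.range (N x), 1 / 2 / 2 ^ n) * ε x := by rw [Finset.sum_mul]
        _ ≤ 1 * ε x := by
            refine mul_le_mul_of_nonneg_right ?_ (hε x)
            exact (summable_geometric_two' 1).sum_le_tsum _ (fun n _ => by positivity) |>.trans_eq
              (tsum_geometric_two' 1)
        _ = ε x := one_mul _

/-! ### Derivatives along a convex set -/

theorem Convex.lipschitzOnWith_of_abs_apply_sub_le {s : Set X} (hs : Convex ℝ s) {f : X → ℝ}
    {f' : X → X →L[ℝ] ℝ} {c : ℝ≥0} (hf : ∀ z ∈ s, HasFDerivAt f (f' z) z)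
    (hf' : ∀ z ∈ s, ∀ v ∈ s, ∀ w ∈ s, |f' z (v - w)| ≤ c * ‖v - w‖) : LipschitzOnWith c f s := by
  refine LipschitzOnWith.of_dist_le_mul fun v hv w hw => ?_
  have hmem : ∀ t ∈ Set.Icc (0 : ℝ) 1, w + t • (v - w) ∈ s := fun t ht =>
    hs.add_smul_sub_mem hw hv ht
  have hline : ∀ t : ℝ, HasDerivAt (fun t : ℝ => w + t • (v - w)) (v - w) t := fun t => by
    simpa using ((hasDerivAt_id t).smul_const (v - w)).const_add w
  have := Convex.norm_image_sub_le_of_norm_hasDerivWithin_le (s := Set.Icc (0 : ℝ) 1)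
    (f := fun t => f (w + t • (v - w))) (f' := fun t => f' (w + t • (v - w)) (v - w))
    (C := c * ‖v - w‖) (x := 0) (y := 1)
    (fun t ht => ((hf _ (hmem t ht)).comp_hasDerivAt t (hline t)).hasDerivWithinAt)
    (fun t ht => hf' _ (hmem t ht) v hv w hw) (convex_Icc 0 1) (by simp) (by simp)
  simpa [dist_eq_norm] using this

/-- The points `y + t (v - y)` and `y + t (w - y)` stay in `s` and differ by `t (v - w)`; divide by
`t` and let `t → 0⁺`. -/
theorem LipschitzOnWith.abs_apply_sub_le {s : Set X} (hs : Convex ℝ s) {f : X → ℝ} {c : ℝ≥0}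
    (hL : LipschitzOnWith c f s) {y : X} (hy : y ∈ s) {f' : X →L[ℝ] ℝ} (hf : HasFDerivAt f f' y)
    {v w : X} (hv : v ∈ s) (hw : w ∈ s) : |f' (v - w)| ≤ c * ‖v - w‖ := by
  have hline : ∀ u : X, HasDerivAt (fun t : ℝ => f (y + t • (u - y))) (f' (u - y)) 0 := fun u => by
    have h1 : HasDerivAt (fun t : ℝ => y + t • (u - y)) (u - y) 0 := by
      simpa using ((hasDerivAt_id (0 : ℝ)).smul_const (u - y)).const_add y
    have h2 : HasFDerivAt f f' (y + (0 : ℝ) • (u - y)) := by simpa using hf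
    exact h2.comp_hasDerivAt (0 : ℝ) h1
  have hd := (hline v).sub (hline w)
  rw [← map_sub, sub_sub_sub_cancel_right] at hd
  refine le_of_tendsto hd.tendsto_slope_zero_right.abs ?_
  filter_upwards [Ioc_mem_nhdsGT (zero_lt_one (α := ℝ))] with t ht
  have ht' : t ∈ Set.Icc (0 : ℝ) 1 := ⟨ht.1.le, ht.2⟩
  have := hL.dist_le_mul _ (hs.add_smul_sub_mem hy hv ht') _ (hs.add_smul_sub_mem hy hw ht')
  rw [dist_eq_norm, dist_eq_norm, add_sub_add_left_eq_sub, ← smul_sub, sub_sub_sub_cancel_right,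
    norm_smul, Real.norm_of_nonneg ht.1.le, Real.norm_eq_abs] at this
  simp only [Pi.sub_apply, zero_add, zero_smul, add_zero, sub_self, sub_zero, smul_eq_mul]
  rw [abs_mul, abs_inv, abs_of_pos ht.1, inv_mul_le_iff₀ ht.1]
  linarith

/-- A functional that is bounded by `c` on the differences of elements of a convex set agrees on
these differences with a functional of norm at most `c`. -/
theorem Convex.exists_norm_le_apply_sub_eq {s : Set X} (hs : Convex ℝ s) (hne : s.Nonempty)
    (f' : X →L[ℝ] ℝ) {c : ℝ} (hc : 0 ≤ c)
    (hf' : ∀ v ∈ s, ∀ w ∈ s, |f' (v - w)| ≤ c * ‖v - w‖) :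
    ∃ T : X →L[ℝ] ℝ, ‖T‖ ≤ c ∧ ∀ v ∈ s, ∀ w ∈ s, T (v - w) = f' (v - w) := by
  obtain ⟨y, hy⟩ := hne
  -- By convexity, the nonnegative multiples of differences are already closed under addition.
  let p : Submodule ℝ X :=
    { carrier := {u | ∃ t : ℝ, 0 ≤ t ∧ ∃ v ∈ s, ∃ w ∈ s, u = t • (v - w)}
      zero_mem' := ⟨0, le_rfl, y, hy, y, hy, by simp⟩
      add_mem' := by
        rintro _ _ ⟨a, ha, v, hv, w, hw, rfl⟩ ⟨b, hb, v', hv', w', hw', rfl⟩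
        rcases (add_nonneg ha hb).eq_or_lt with h | h
        · refine ⟨0, le_rfl, y, hy, y, hy, ?_⟩
          rw [show a = 0 by linarith, show b = 0 by linarith]; simp
        · have hab : a / (a + b) + b / (a + b) = 1 := by field_simp
          refine ⟨a + b, h.le, _, hs hv hv' (div_nonneg ha h.le) (div_nonneg hb h.le) hab, _,
            hs hw hw' (div_nonneg ha h.le) (div_nonneg hb h.le) hab, ?_⟩
          simp only [smul_sub, smul_add, smul_smul, mul_div_cancel₀ _ h.ne']
          abel
      smul_mem' := by
        rintro a _ ⟨t, ht, v, hv, w, hw, rfl⟩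
        rcases le_total 0 a with ha | ha
        · exact ⟨a * t, mul_nonneg ha ht, v, hv, w, hw, smul_smul _ _ _⟩
        · refine ⟨-a * t, mul_nonneg (neg_nonneg.2 ha) ht, w, hw, v, hv, ?_⟩
          rw [smul_smul, ← neg_sub v w, smul_neg, neg_mul, neg_smul, neg_neg] }
  have hp : ∀ v ∈ s, ∀ w ∈ s, v - w ∈ p := fun v hv w hw =>
    ⟨1, zero_le_one, v, hv, w, hw, (one_smul _ _).symm⟩
  obtain ⟨T, hT, hnorm⟩ := exists_extension_norm_eq p (f'.comp p.subtypeL)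
  refine ⟨T, ?_, fun v hv w hw => hT ⟨v - w, hp v hv w hw⟩⟩
  rw [hnorm]
  refine ContinuousLinearMap.opNorm_le_bound _ hc ?_
  rintro ⟨_, t, ht, v, hv, w, hw, rfl⟩
  simp only [ContinuousLinearMap.comp_apply, Submodule.subtypeL_apply, Submodule.coe_norm,
    map_smul, norm_smul, Real.norm_eq_abs, smul_eq_mul, abs_mul]
  calc |t| * |f' (v - w)| ≤ |t| * (c * ‖v - w‖) := by gcongr; exact hf' v hv w hw
    _ = _ := by ring

/-! ### Smooth approximation on a convex set -/

theorem LipschitzSmoothApprox.exists_contDiff_approx_on_convex (hX : LipschitzSmoothApprox X C₀)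
    {Y : Set X} (hYc : IsClosed Y) (hY : Convex ℝ Y) {f : X → ℝ}
    (hf : ∀ y ∈ Y, DifferentiableAt ℝ f y) (hf' : ContinuousOn (fderiv ℝ f) Y)
    {B : Set (X →L[ℝ] ℝ)} (hB : Convex ℝ B)
    (hT : ∀ y ∈ Y, ∃ T ∈ B, ∀ v ∈ Y, ∀ w ∈ Y, T (v - w) = fderiv ℝ f y (v - w))
    {ε : ℝ≥0} (hε : 0 < ε) :
    ∃ g : X → ℝ, ContDiff ℝ 1 g ∧ (∀ z ∈ Y, |f z - g z| ≤ ε) ∧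
      (∀ z ∈ Y, ∃ b ∈ B, ‖fderiv ℝ g z - b‖ ≤ ε) ∧ LipschitzOnWith ε (fun z => f z - g z) Y := by
  -- Both constraints use `ε / 2`; the other half absorbs the gluing error.
  let K : X → Set (X →L[ℝ] ℝ) := fun z => {k | (∃ b ∈ B, ‖k - b‖ ≤ ε / 2) ∧
    ∀ v ∈ Y, ∀ w ∈ Y, |(k - fderiv ℝ f z) (v - w)| ≤ ε / 2 * ‖v - w‖}
  have hK : ∀ z, Convex ℝ (K z) := by
    rintro z k₁ ⟨⟨b₁, hb₁, hk₁⟩, h₁⟩ k₂ ⟨⟨b₂, hb₂, hk₂⟩, h₂⟩ a b ha hb hab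
    refine ⟨⟨_, hB hb₁ hb₂ ha hb hab, ?_⟩, fun v hv w hw => ?_⟩
    · have : a • k₁ + b • k₂ - (a • b₁ + b • b₂) = a • (k₁ - b₁) + b • (k₂ - b₂) := by
        simp only [smul_sub]; abel
      rw [this]
      refine (norm_add_le _ _).trans ?_
      rw [norm_smul, norm_smul, Real.norm_of_nonneg ha, Real.norm_of_nonneg hb]
      calc _ ≤ a * (ε / 2 : ℝ) + b * (ε / 2) := by gcongr
        _ = _ := by rw [← add_mul, hab, one_mul]
    · have : (a • k₁ + b • k₂ - fderiv ℝ f z) (v - w) =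
          a * (k₁ - fderiv ℝ f z) (v - w) + b * (k₂ - fderiv ℝ f z) (v - w) := by
        simp only [sub_apply, add_apply,
          smul_apply, smul_eq_mul]
        linear_combination (fderiv ℝ f z (v - w)) * hab
      rw [this]
      refine (abs_add_le _ _).trans ?_
      rw [abs_mul, abs_mul, abs_of_nonneg ha, abs_of_nonneg hb]
      calc _ ≤ a * (ε / 2 * ‖v - w‖) + b * (ε / 2 * ‖v - w‖) := by
            gcongr
            · exact h₁ v hv w hw
            · exact h₂ v hv w hw
        _ = _ := by rw [← add_mul, hab, one_mul]
  have hε2 : (0 : ℝ) < ε / 2 := by have : (0 : ℝ) < ε := hε; linarith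
  obtain ⟨g, hg, hgY⟩ := hX.exists_glue Y f K hK (fun _ => ε / 2) (fun _ => hε2.le) fun x => by
    by_cases hx : x ∈ Y
    swap
    · exact ⟨Yᶜ, hYc.isOpen_compl, hx, fun η _ => ⟨0, contDiffOn_const,
        fun z hz hz' => absurd hz' hz⟩⟩
    obtain ⟨T, hTB, hTD⟩ := hT x hx
    -- `e` bounds the oscillation of `f'` and `C₀ * e` the derivative of the smoothed correction;
    -- together they make `ε / 2`.
    let e : ℝ≥0 := ε / 2 / (1 + C₀)
    have he : 0 < e := by positivity
    have heε : (e : ℝ) + C₀ * e = ε / 2 := by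
      have : (0 : ℝ) < 1 + C₀ := by positivity
      simp only [e, NNReal.coe_div, NNReal.coe_add, NNReal.coe_one, NNReal.coe_ofNat]
      field_simp
    obtain ⟨r, hr, hball⟩ := Metric.continuousOn_iff.1 hf' x hx e he
    have hdiff : ∀ z ∈ Y ∩ Metric.ball x r, ∀ v ∈ Y, ∀ w ∈ Y,
        |(fderiv ℝ f z - T) (v - w)| ≤ e * ‖v - w‖ := by
      intro z hz v hv w hw
      rw [sub_apply, hTD v hv w hw, ← sub_apply]
      refine ((fderiv ℝ f z - fderiv ℝ f x).le_opNorm _).trans ?_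
      gcongr
      exact (dist_eq_norm (fderiv ℝ f z) _ ▸ hball z hz.1 hz.2).le
    have hlip : LipschitzOnWith e (fun z => f z - T z) (Y ∩ Metric.ball x r) :=
      (hY.inter (convex_ball x r)).lipschitzOnWith_of_abs_apply_sub_le
        (fun z hz => (hf z hz.1).hasFDerivAt.sub T.hasFDerivAt)
        fun z hz v hv w hw => hdiff z hz v hv.1 w hw.1
    obtain ⟨φ, hφL, hφ⟩ := hlip.extend_real
    refine ⟨Metric.ball x r, Metric.isOpen_ball, Metric.mem_ball_self hr, fun η hη => ?_⟩
    obtain ⟨d, hd, hdφ, hdL⟩ := hX φ e hφL (η * (ε / 2)) (by positivity)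
    have hder : ∀ z, fderiv ℝ (fun z => T z + d z) z = T + fderiv ℝ d z := fun z =>
      (T.hasFDerivAt.add (hd.differentiable one_ne_zero z).hasFDerivAt).fderiv
    have hd' : ∀ z, ‖fderiv ℝ d z‖ ≤ C₀ * e := fun z => by
      simpa using norm_fderiv_le_of_lipschitz ℝ hdL (x₀ := z)
    refine ⟨fun z => T z + d z, (T.contDiff.add hd).contDiffOn, fun z hz hzY => ⟨?_, ?_⟩⟩
    · have h1 : f z - T z = φ z := hφ ⟨hzY, hz⟩
      have : T z + d z - f z = -(φ z - d z) := by rw [← h1]; ring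
      rw [this, abs_neg]
      exact (hdφ z).le
    · rw [hder]
      refine ⟨⟨T, hTB, ?_⟩, fun v hv w hw => ?_⟩
      · rw [add_sub_cancel_left]
        exact (hd' z).trans (by rw [← heε]; linarith [show (0 : ℝ) < e from he])
      · have : (T + fderiv ℝ d z - fderiv ℝ f z) (v - w) =
            -((fderiv ℝ f z - T) (v - w)) + fderiv ℝ d z (v - w) := by
          simp only [sub_apply, add_apply]; ring
        rw [this, ← heε, add_mul]
        refine (abs_add_le _ _).trans (add_le_add ?_ ?_)
        · rw [abs_neg]; exact hdiff z ⟨hzY, hz⟩ v hv w hw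
        · exact (fderiv ℝ d z).le_of_opNorm_le (hd' z) _
  refine ⟨g, hg, fun z hz => ?_, fun z hz => ?_, ?_⟩
  · rw [abs_sub_comm]; linarith [(hgY z hz).1]
  · obtain ⟨k, ⟨⟨b, hb, hkb⟩, -⟩, hgk⟩ := (hgY z hz).2
    refine ⟨b, hb, (norm_sub_le_norm_sub_add_norm_sub _ k _).trans ?_⟩
    linarith
  · refine hY.lipschitzOnWith_of_abs_apply_sub_le (fun z hz =>
      (hf z hz).hasFDerivAt.sub (hg.differentiable one_ne_zero z).hasFDerivAt)
      fun z hz v hv w hw => ?_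
    obtain ⟨k, ⟨-, hk⟩, hgk⟩ := (hgY z hz).2
    have : (fderiv ℝ f z - fderiv ℝ g z) (v - w) =
        -((k - fderiv ℝ f z) (v - w) + (fderiv ℝ g z - k) (v - w)) := by
      simp only [sub_apply]; ring
    rw [this, abs_neg]
    refine (abs_add_le _ _).trans ?_
    have h1 := hk v hv w hw
    have h2 : |(fderiv ℝ g z - k) (v - w)| ≤ ε / 2 * ‖v - w‖ :=
      (fderiv ℝ g z - k).le_of_opNorm_le hgk _
    linarith

/-! ### Lipschitz control off the convex set -/

/-- A `C¹` function that is `M`-Lipschitz on `Y` and has derivative smaller than `M` there is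
Lipschitz on a neighbourhood of `Y`. -/
theorem LipschitzOnWith.exists_isOpen_superset_of_nnnorm_fderiv_lt {Y : Set X} {g : X → ℝ}
    (hg : ContDiff ℝ 1 g) {M : ℝ≥0} (hM : ∀ y ∈ Y, ‖fderiv ℝ g y‖₊ < M)
    (hL : LipschitzOnWith M g Y) : ∃ O, IsOpen O ∧ Y ⊆ O ∧ LipschitzOnWith (5 * M) g O := by
  have hball : ∀ y ∈ Y, ∃ r > 0, LipschitzOnWith M g (Metric.ball y r) := fun y hy => by
    obtain ⟨t, ht, hgt⟩ := hg.contDiffAt.exists_lipschitzOnWith_of_nnnorm_lt M (hM y hy)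
    obtain ⟨r, hr, hrt⟩ := Metric.mem_nhds_iff.1 ht
    exact ⟨r, hr, hgt.mono hrt⟩
  choose! r hr hgr using hball
  refine ⟨⋃ y ∈ Y, Metric.ball y (r y / 3), isOpen_biUnion fun y _ => Metric.isOpen_ball,
    fun y hy => Set.mem_biUnion hy (Metric.mem_ball_self (by linarith [hr y hy])), ?_⟩
  have key : ∀ y ∈ Y, ∀ y' ∈ Y, r y' ≤ r y → ∀ x ∈ Metric.ball y (r y / 3),
      ∀ x' ∈ Metric.ball y' (r y' / 3), dist (g x) (g x') ≤ 5 * M * dist x x' := by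
    intro y hy y' hy' hle x hx x' hx'
    have hr0 := hr y hy
    have hr0' := hr y' hy'
    rw [Metric.mem_ball] at hx hx'
    have hM0 : (0 : ℝ) ≤ M := M.2
    have hxy : dist (g x) (g y) ≤ M * dist x y :=
      (hgr y hy).dist_le_mul x (Metric.mem_ball.2 (by linarith)) y (Metric.mem_ball_self hr0)
    -- Nearby points lie in one ball. Otherwise both centre distances are at most `dist x x'`, and
    -- the path through the centres costs `1 + 3 + 1 = 5`.
    rcases lt_or_ge (dist x x') (r y / 3) with h | h
    · have hx'y : dist x' y < r y := by
        have := dist_triangle_left x' y x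
        linarith
      refine ((hgr y hy).dist_le_mul x (Metric.mem_ball.2 (by linarith)) x' hx'y).trans ?_
      gcongr
      linarith
    · have h1 : dist (g x') (g y') ≤ M * dist x' y' :=
        (hgr y' hy').dist_le_mul x' (Metric.mem_ball.2 (by linarith)) y' (Metric.mem_ball_self hr0')
      have h2 : dist (g y) (g y') ≤ M * dist y y' := hL.dist_le_mul y hy y' hy'
      have h3 : dist y y' ≤ 3 * dist x x' := by
        have e1 := dist_triangle4 y x x' y'
        rw [dist_comm y x] at e1
        linarith
      have h4 : dist (g x) (g x') ≤ dist (g x) (g y) + dist (g y) (g y') + dist (g x') (g y') := by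
        rw [dist_comm (g x') (g y')]
        exact dist_triangle4 _ _ _ _
      calc dist (g x) (g x') ≤ M * dist x x' + M * (3 * dist x x') + M * dist x x' := by
            refine h4.trans (add_le_add_three (hxy.trans ?_) (h2.trans ?_) (h1.trans ?_))
            · gcongr; linarith
            · gcongr
            · gcongr; linarith
        _ = _ := by ring
  refine LipschitzOnWith.of_dist_le_mul fun x hx x' hx' => ?_
  simp only [Set.mem_iUnion, exists_prop] at hx hx'
  obtain ⟨y, hy, hx⟩ := hx
  obtain ⟨y', hy', hx'⟩ := hx'
  push_cast
  rcases le_total (r y') (r y) with h | h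
  · exact key y hy y' hy' h x hx x' hx'
  · rw [dist_comm, dist_comm x]
    exact key y' hy' y hy h x' hx' x hx

theorem LipschitzSmoothApprox.exists_lipschitz_contDiff_eqOn (hX : LipschitzSmoothApprox X C₀)
    {Y : Set X} (hYc : IsClosed Y) (hne : Y.Nonempty) {g : X → ℝ} (hg : ContDiff ℝ 1 g) {M : ℝ≥0}
    (hM : ∀ y ∈ Y, ‖fderiv ℝ g y‖₊ < M) (hL : LipschitzOnWith M g Y) :
    ∃ H : X → ℝ, ContDiff ℝ 1 H ∧ Set.EqOn H g Y ∧ LipschitzWith ((5 * C₀ + 6) * M) H := by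
  obtain ⟨O, hO, hYO, hgO⟩ := hL.exists_isOpen_superset_of_nnnorm_fderiv_lt hg hM
  obtain ⟨Φ, hΦ, hΦg⟩ := hgO.extend_real
  have hM0 : (0 : ℝ) < M := by
    obtain ⟨y, hy⟩ := hne
    exact (zero_le (a := ‖fderiv ℝ g y‖₊)).trans_lt (hM y hy)
  -- Vanishing on `Y` forces `H = g` there; the bound `M` adds at most `M` to the derivative.
  let ε : X → ℝ := fun z => min (Metric.infDist z Y) 1 * M
  have hε : ∀ z, 0 ≤ ε z := fun z =>
    mul_nonneg (le_min Metric.infDist_nonneg zero_le_one) hM0.le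
  obtain ⟨H, hH, hHΦ⟩ := hX.exists_glue Set.univ Φ
    (fun _ => Metric.closedBall 0 ((5 * C₀ + 5) * M)) (fun _ => convex_closedBall _ _) ε hε
    fun x => by
      by_cases hx : x ∈ O
      · refine ⟨O, hO, hx, fun η hη => ⟨g, hg.contDiffOn, fun z hz _ => ⟨?_, ?_⟩⟩⟩
        · rw [hΦg hz, sub_self, abs_zero]
          exact mul_nonneg hη.le (hε z)
        · have := norm_fderiv_le_of_lipschitzOn ℝ (hO.mem_nhds hz) hgO
          rw [mem_closedBall_zero_iff]
          refine this.trans ?_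
          push_cast
          gcongr
          linarith [C₀.2]
      · have hd : 0 < Metric.infDist x Y :=
          (hYc.notMem_iff_infDist_pos hne).1 fun h => hx (hYO h)
        refine ⟨{z | Metric.infDist x Y / 2 < Metric.infDist z Y},
          isOpen_lt continuous_const (Metric.continuous_infDist_pt Y),
          half_lt_self hd, fun η hη => ?_⟩
        obtain ⟨k, hk, hkΦ, hkL⟩ := hX Φ _ hΦ (η * (min (Metric.infDist x Y / 2) 1 * M))
          (by positivity)
        refine ⟨k, hk.contDiffOn, fun z hz _ => ⟨?_, ?_⟩⟩
        · rw [abs_sub_comm]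
          refine (hkΦ z).le.trans ?_
          have : Metric.infDist x Y / 2 ≤ Metric.infDist z Y := le_of_lt hz
          simp only [ε]
          gcongr
        · rw [mem_closedBall_zero_iff]
          refine (norm_fderiv_le_of_lipschitz ℝ hkL).trans ?_
          push_cast
          linarith
  refine ⟨H, hH, fun y hy => ?_, lipschitzWith_of_nnnorm_fderiv_le
    (hH.differentiable one_ne_zero) fun x => ?_⟩
  · have := (hHΦ y trivial).1
    simp only [ε, Metric.infDist_zero_of_mem hy, min_eq_left zero_le_one, zero_mul] at this
    rw [hΦg (hYO hy)]
    exact sub_eq_zero.1 (abs_nonpos_iff.1 this)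
  · obtain ⟨k, hk, hHk⟩ := (hHΦ x trivial).2
    rw [mem_closedBall_zero_iff] at hk
    have h1 : ε x ≤ M := mul_le_of_le_one_left hM0.le (min_le_right _ _)
    have h2 := norm_le_norm_add_norm_sub k (fderiv ℝ H x)
    rw [norm_sub_rev] at h2
    rw [← NNReal.coe_le_coe]
    push_cast
    linarith

/-! ### Successive approximation -/

theorem LipschitzSmoothApprox.exists_halving (hX : LipschitzSmoothApprox X C₀)
    {Y : Set X} (hYc : IsClosed Y) (hY : Convex ℝ Y) (hne : Y.Nonempty) {f : X → ℝ}
    (hf : ∀ y ∈ Y, DifferentiableAt ℝ f y) (hf' : ContinuousOn (fderiv ℝ f) Y) {L : ℝ≥0}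
    (hL0 : 0 < L) (hL : LipschitzOnWith L f Y) :
    ∃ H : X → ℝ, ContDiff ℝ 1 H ∧ LipschitzWith ((10 * C₀ + 12) * L) H ∧
      (∀ z ∈ Y, |f z - H z| ≤ L) ∧ LipschitzOnWith (L / 2) (fun z => f z - H z) Y := by
  obtain ⟨g, hg, hfg, hg', hfgL⟩ := hX.exists_contDiff_approx_on_convex hYc hY hf hf'
    (convex_closedBall (0 : X →L[ℝ] ℝ) L) (fun y hy => by
      obtain ⟨T, hT, hTf⟩ := hY.exists_norm_le_apply_sub_eq hne (fderiv ℝ f y) L.2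
        fun v hv w hw => hL.abs_apply_sub_le hY hy (hf y hy).hasFDerivAt hv hw
      exact ⟨T, mem_closedBall_zero_iff.2 hT, hTf⟩) (half_pos hL0)
  have hL0' : (0 : ℝ) < L := hL0
  -- The bound `L + L / 2 < 2 * L` supplies the required strict inequality.
  have hgM : ∀ y ∈ Y, ‖fderiv ℝ g y‖₊ < 2 * L := fun y hy => by
    obtain ⟨b, hb, hgb⟩ := hg' y hy
    rw [mem_closedBall_zero_iff] at hb
    have h2 := norm_le_norm_add_norm_sub b (fderiv ℝ g y)
    rw [norm_sub_rev] at h2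
    rw [← NNReal.coe_lt_coe]
    push_cast at hgb ⊢
    linarith
  have hgL : LipschitzOnWith (2 * L) g Y := by
    have := (hL.sub hfgL).weaken (K' := 2 * L) (by
      rw [← NNReal.coe_le_coe]; push_cast; linarith)
    simpa using this
  obtain ⟨H, hH, hHg, hHL⟩ := hX.exists_lipschitz_contDiff_eqOn hYc hne hg hgM hgL
  refine ⟨H, hH, ?_, fun z hz => ?_, ?_⟩
  · convert hHL using 1
    ring
  · rw [hHg hz]
    refine (hfg z hz).trans ?_
    push_cast
    linarith
  · intro v hv w hw
    simp only [hHg hv, hHg hw]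
    exact hfgL hv hw

theorem LipschitzSmoothApprox.exists_lipschitz_extension (hX : LipschitzSmoothApprox X C₀)
    {Y : Set X} (hYc : IsClosed Y) (hY : Convex ℝ Y) {f : X → ℝ}
    (hf : ∀ y ∈ Y, DifferentiableAt ℝ f y) (hf' : ContinuousOn (fderiv ℝ f) Y) {L : ℝ≥0}
    (hL : LipschitzOnWith L f Y) :
    ∃ H : X → ℝ, ContDiff ℝ 1 H ∧ Set.EqOn H f Y ∧ LipschitzWith ((20 * C₀ + 24) * L) H := by
  rcases Y.eq_empty_or_nonempty with rfl | hne
  · exact ⟨0, contDiff_const, Set.eqOn_empty _ _, LipschitzWith.const' 0⟩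
  obtain ⟨y₀, hy₀⟩ := hne
  rcases (zero_le (a := L)).eq_or_lt with rfl | hL0
  · refine ⟨fun _ => f y₀, contDiff_const, fun y hy => ?_, LipschitzWith.const' _⟩
    have := hL.dist_le_mul y₀ hy₀ y hy
    rw [NNReal.coe_zero, zero_mul] at this
    exact dist_le_zero.1 this
  let Good : ℕ → (X → ℝ) → Prop := fun n F => (∀ y ∈ Y, DifferentiableAt ℝ F y) ∧
    ContinuousOn (fderiv ℝ F) Y ∧ LipschitzOnWith (L / 2 ^ n) F Y
  have hstep : ∀ n F, Good n F → ∃ H : X → ℝ, ContDiff ℝ 1 H ∧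
      LipschitzWith ((10 * C₀ + 12) * (L / 2 ^ n)) H ∧ (∀ z ∈ Y, |F z - H z| ≤ L / 2 ^ n) ∧
      Good (n + 1) fun z => F z - H z := by
    rintro n F ⟨hF, hF', hFL⟩
    obtain ⟨H, hH, hHL, hFH, hFHL⟩ := hX.exists_halving hYc hY ⟨y₀, hy₀⟩ hF hF'
      (show 0 < L / 2 ^ n by positivity) hFL
    refine ⟨H, hH, hHL, by simpa using hFH,
      fun y hy => (hF y hy).sub (hH.differentiable one_ne_zero y), ?_, ?_⟩
    · refine (hF'.sub (hH.continuous_fderiv one_ne_zero).continuousOn).congr fun y hy => ?_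
      exact fderiv_fun_sub (hF y hy) (hH.differentiable one_ne_zero y)
    · rwa [pow_succ, ← div_div]
  choose! H hH hHL hHF hHG using hstep
  let F : ℕ → X → ℝ := fun n => Nat.rec f (fun n F z => F z - H n F z) n
  have hF : ∀ n, Good n (F n) := fun n => by
    induction n with
    | zero => exact ⟨hf, hf', by simpa [F] using hL⟩
    | succ n ih => exact hHG n _ ih
  let h : ℕ → X → ℝ := fun n => H n (F n)
  have hFs : ∀ n z, F (n + 1) z = F n z - h n z := fun n z => rfl
  have hh : ∀ n, ContDiff ℝ 1 (h n) := fun n => hH n _ (hF n)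
  have hsmall : ∀ n, ∀ z ∈ Y, |F (n + 1) z| ≤ L / 2 ^ n := fun n z hz => hHF n _ (hF n) z hz
  -- This is `(10 * C₀ + 12) * L / 2 ^ n`, written to match the geometric sum.
  let u : ℕ → ℝ := fun n => (20 * C₀ + 24) * L / 2 / 2 ^ n
  have hu : HasSum u ((20 * C₀ + 24) * L) := hasSum_geometric_two' _
  have hderiv : ∀ n x, ‖fderiv ℝ (h n) x‖ ≤ u n := fun n x => by
    refine (norm_fderiv_le_of_lipschitz ℝ (hHL n _ (hF n))).trans_eq ?_
    simp only [u]
    push_cast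
    ring
  have hsum : ∀ z ∈ Y, HasSum (fun n => h n z) (f z) := by
    intro z hz
    have hpart : ∀ n, ∑ k ∈ Finset.range n, h k z = f z - F n z := fun n => by
      induction n with
      | zero => simp [F]
      | succ n ih => rw [Finset.sum_range_succ, ih, hFs]; ring
    have h0 : Filter.Tendsto (fun n => F n z) Filter.atTop (nhds 0) := by
      rw [← Filter.tendsto_add_atTop_iff_nat 1]
      refine squeeze_zero_norm (fun n => hsmall n z hz) ?_
      exact tendsto_const_nhds.div_atTop (tendsto_pow_atTop_atTop_of_one_lt one_lt_two)
    have hs : Summable fun n => h n z := by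
      -- The first term is dropped: `F 0 = f` may be unbounded on `Y`, and only later remainders are
      -- uniformly small.
      rw [← summable_nat_add_iff 1]
      refine Summable.of_norm_bounded (summable_geometric_two' (4 * (L : ℝ))) fun n => ?_
      have e1 : h (n + 1) z = F (n + 1) z - F (n + 1 + 1) z := by rw [hFs (n + 1)]; ring
      have e2 : (L : ℝ) / 2 ^ (n + 1) ≤ L / 2 ^ n := by
        gcongr
        · norm_num
        · exact Nat.le_succ n
      rw [e1, Real.norm_eq_abs]
      refine (abs_sub _ _).trans ((add_le_add (hsmall n z hz) (hsmall (n + 1) z hz)).trans ?_)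
      rw [show 4 * (L : ℝ) / 2 / 2 ^ n = L / 2 ^ n + L / 2 ^ n by ring]
      linarith
    have hlim := h0.const_sub (f z)
    rw [sub_zero] at hlim
    simp only [← hpart] at hlim
    rw [← tendsto_nhds_unique hs.hasSum.tendsto_sum_nat hlim]
    exact hs.hasSum
  have hd : ∀ x, HasFDerivAt (fun z => ∑' n, h n z) (∑' n, fderiv ℝ (h n) x) x :=
    hasFDerivAt_tsum hu.summable
      (fun n x => ((hh n).differentiable one_ne_zero x).hasFDerivAt) hderiv (hsum y₀ hy₀).summable
  have hfd : fderiv ℝ (fun z => ∑' n, h n z) = fun x => ∑' n, fderiv ℝ (h n) x :=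
    funext fun x => (hd x).fderiv
  refine ⟨fun z => ∑' n, h n z, contDiff_one_iff_fderiv.2 ⟨fun x => (hd x).differentiableAt, ?_⟩,
    fun z hz => (hsum z hz).tsum_eq, lipschitzWith_of_nnnorm_fderiv_le
      (fun x => (hd x).differentiableAt) fun x => ?_⟩
  · rw [hfd]
    exact continuous_tsum (fun n => (hh n).continuous_fderiv one_ne_zero) hu.summable hderiv
  · rw [hfd, ← NNReal.coe_le_coe]
    push_cast
    exact tsum_of_norm_bounded hu fun n => hderiv n x

theorem LipschitzSmoothApprox.exists_extension (hX : LipschitzSmoothApprox X C₀)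
    {Y : Set X} (hYc : IsClosed Y) (hY : Convex ℝ Y) {f : X → ℝ}
    (hf : ∀ y ∈ Y, DifferentiableAt ℝ f y) (hf' : ContinuousOn (fderiv ℝ f) Y) :
    ∃ H : X → ℝ, ContDiff ℝ 1 H ∧ Set.EqOn H f Y := by
  obtain ⟨g, hg, -, -, hL⟩ := hX.exists_contDiff_approx_on_convex hYc hY hf hf' convex_univ
    (fun y _ => ⟨fderiv ℝ f y, trivial, fun _ _ _ _ => rfl⟩) one_pos
  obtain ⟨H, hH, hHf, -⟩ := hX.exists_lipschitz_extension hYc hY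
    (fun y hy => (hf y hy).sub (hg.differentiable one_ne_zero y))
    ((hf'.sub (hg.continuous_fderiv one_ne_zero).continuousOn).congr fun y hy =>
      fderiv_fun_sub (hf y hy) (hg.differentiable one_ne_zero y)) hL
  exact ⟨fun z => g z + H z, hg.add hH, fun z hz => by simp [hHf hz]⟩

theorem IsC1OnAsFunctionOn.differentiableAt_and_continuousOn_fderiv {f : X → ℝ} {U Y : Set X}
    (hU : IsOpen U) (hYU : Y ⊆ U) (h : IsC1OnAsFunctionOn f U Y) :
    (∀ y ∈ Y, DifferentiableAt ℝ f y) ∧ ContinuousOn (fderiv ℝ f) Y :=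
  ⟨fun y hy => (h.1 y hy).differentiableAt (hU.mem_nhds (hYU hy)),
    h.2.congr fun _ hy => (fderivWithin_of_isOpen hU (hYU hy)).symm⟩

end

theorem mainTheorem3 (X : Type*) [NormedAddCommGroup X] [NormedSpace ℝ X] [CompleteSpace X]
    (hX : PropertyStar X) :
    (∀ (Y U : Set X) (f : X → ℝ), IsClosed Y → Convex ℝ Y → IsOpen U → Y ⊆ U →
      IsC1OnAsFunctionOn f U Y →
        ∃ H : X → ℝ, ContDiff ℝ 1 H ∧ Set.EqOn H f Y) ∧
    (∃ C : ℝ≥0, ∀ (Y U : Set X) (f : X → ℝ), IsClosed Y → Convex ℝ Y → IsOpen U → Y ⊆ U →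
      IsC1OnAsFunctionOn f U Y → (∃ L : ℝ≥0, LipschitzOnWith L f Y) →
        ∃ H : X → ℝ, ContDiff ℝ 1 H ∧ Set.EqOn H f Y ∧
          LipschitzWith (C * lipConst f Y) H) := by
  obtain ⟨C₀, hC⟩ := hX.exists_lipschitzSmoothApprox
  refine ⟨fun Y U f hYc hY hU hYU hf => ?_, 20 * C₀ + 24, fun Y U f hYc hY hU hYU hf hL => ?_⟩
  · obtain ⟨h1, h2⟩ := hf.differentiableAt_and_continuousOn_fderiv hU hYU
    exact hC.exists_extension hYc hY h1 h2
  · obtain ⟨h1, h2⟩ := hf.differentiableAt_and_continuousOn_fderiv hU hYU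
    exact hC.exists_lipschitz_extension hYc hY h1 h2 (lipschitzOnWith_lipConst hL)
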